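/- Let $n\ge 1$, $m_1,m_2\ge 0$ be integers, $m=m_1+m_2\geq 1$, $p_{\mathrm{fail}}=m_2/m$. Let $a_1,\dots,a_m$ be i.i.d. random vectors in $\mathbb{R}^n$, distributed as a generic random vector $a$ that has mean $0$ and covariance matrix $\Sigma$ and is $\sigma^2$-subGaussian, i.e. $\mathbb{E}\,e^{\langle v,a\rangle}\le e^{\sigma^2\|v\|_2^2/2}$ for all $v\in\mathbb{R}^n$. Let $x_\star\in\mathbb{R}^n\setminus\{0\}$, let $b_i=\langle a_i,x_\star\rangle^2$ for $i\le m_1$ and $b_i=\xi_i$ for $m_1<i\le m$, where the $\xi_i$ are nonnegative random variables with an arbitrary joint distribution (they may depend on the $a_i$). For $x\in\mathbb{R}^n$ put $$r_i(x)=\big|\langle a_i,x\rangle^2-b_i\big|,\qquad F(x)=\frac1m\sum_{i=1}^m r_i(x),$$ and, for $\tilde p\in(0,1)$ with $m\tilde p\in\mathbb{N}$, let $r^{\tilde p}(x)$ be the $(m\tilde p)$-th smallest of the numbers $r_1(x),\dots,r_m(x)$ (counted with multiplicity). Let $\|\Sigma\|_2$ be the spectral norm, let $\mathbb{S}^{n-1}$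 be the Euclidean unit sphere, and let $$\kappa_{\mathrm{st}}=\inf_{u,v\in\mathbb{S}^{n-1}}\mathbb{E}\,|\langle a,u\rangle\langle a,v\rangle|,\qquad p_0=\inf_{u,v\in\mathbb{S}^{n-1}}\mathbb{P}\big(\min\{|\langle a,u\rangle|,|\langle a,v\rangle|\}\ge\kappa\big),$$ where $\kappa>0$. Theorem. Assume that $p_{\mathrm{fail}}<\tfrac12$, $\kappa_{\mathrm{st}}-2p_{\mathrm{fail}}\|\Sigma\|_2>0$, $\tilde p\in(p_{\mathrm{fail}},1-p_{\mathrm{fail}})$, $m\tilde p\in\mathbb{N}$ and $p_0>\dfrac{1-\tilde p}{1-p_{\mathrm{fail}}}$. Then there are positive constants $u_L,u_H,\rho_1,\rho_2,\rho_3$, depending only on $\|\Sigma\|_2,\sigma,\kappa_{\mathrm{st}},\kappa,p_0,p_{\mathrm{fail}},\tilde p$ (in particular not on $n$, $m$, $x_\star$, or the distribution of the corruptions), such that whenever $m\ge\rho_1 n$, $$\mathbb{P}\Big(u_L\big(F(x)-F(x_\star)\big)\le r^{\tilde p}(x)\le u_H\big(F(x)-F(x_\star)\big)\ \text{ for all }x\in\mathbb{R}^n\Big)\ge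 1-\rho_2e^{-\rho_3m}.$$ -/

import Mathlib

open MeasureTheory ProbabilityTheory
open scoped NNReal

namespace RobustPhaseRetrieval

noncomputable section

/-- The law `ν` on `ℝⁿ` is `σ²`-subGaussian (as a centered law): for every direction `v` and every
real `t`, `∫ exp (t ⟨v, y⟩) dν(y) ≤ exp (σ² ‖v‖² t² / 2)`. -/
def IsSubGaussian {n : ℕ} (ν : Measure (EuclideanSpace ℝ (Fin n))) (σ : ℝ≥0) : Prop :=
  ∀ v : EuclideanSpace ℝ (Fin n),
    HasSubgaussianMGF (fun y => inner ℝ v y) (σ ^ 2 * ‖v‖₊ ^ 2) ν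

/-- The covariance matrix `Σ` of a law on `ℝⁿ`. -/
def covarianceMatrix {n : ℕ} (ν : Measure (EuclideanSpace ℝ (Fin n))) : Matrix (Fin n) (Fin n) ℝ :=
  Matrix.of fun i j => covariance (fun y => y i) (fun y => y j) ν

/-- The spectral norm `‖M‖₂` of a square matrix, its operator norm for the Euclidean norm. -/
def specNorm {n : ℕ} (M : Matrix (Fin n) (Fin n) ℝ) : ℝ :=
  ‖Matrix.toEuclideanCLM (n := Fin n) (𝕜 := ℝ) M‖

/-- The stability constant `κ_st = inf_{u, v ∈ 𝕊ⁿ⁻¹} 𝔼 |⟨a, u⟩ ⟨a, v⟩|`, where `a` has law `ν`. -/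
def kappaSt {n : ℕ} (ν : Measure (EuclideanSpace ℝ (Fin n))) : ℝ :=
  ⨅ u : Metric.sphere (0 : EuclideanSpace ℝ (Fin n)) 1,
    ⨅ v : Metric.sphere (0 : EuclideanSpace ℝ (Fin n)) 1,
      ∫ y, |inner ℝ y (u : EuclideanSpace ℝ (Fin n)) *
        inner ℝ y (v : EuclideanSpace ℝ (Fin n))| ∂ν

/-- `inf_{u, v ∈ 𝕊ⁿ⁻¹} ℙ (min {|⟨a, u⟩|, |⟨a, v⟩|} ≥ κ)`, where `a` has law `ν`. -/
def smallBallProb {n : ℕ} (ν : Measure (EuclideanSpace ℝ (Fin n))) (κ : ℝ) : ℝ :=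
  ⨅ u : Metric.sphere (0 : EuclideanSpace ℝ (Fin n)) 1,
    ⨅ v : Metric.sphere (0 : EuclideanSpace ℝ (Fin n)) 1,
      ν.real {y | κ ≤ min |inner ℝ y (u : EuclideanSpace ℝ (Fin n))|
        |inner ℝ y (v : EuclideanSpace ℝ (Fin n))|}

/-- The measurements `b`: the first `m₁` are the exact values `⟨a_i, x⋆⟩²`, the last `m₂` are
the corruptions `ξ`. -/
def measurements {n m₁ m₂ : ℕ} (a : Fin (m₁ + m₂) → EuclideanSpace ℝ (Fin n))
    (xs : EuclideanSpace ℝ (Fin n)) (ξ : Fin m₂ → ℝ) : Fin (m₁ + m₂) → ℝ :=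
  Fin.append (fun i : Fin m₁ => (inner ℝ (a (Fin.castAdd m₂ i)) xs) ^ 2) ξ

/-- The absolute absResidual `r_i(x) = |⟨a_i, x⟩² - b_i|`. -/
def absResidual {n m : ℕ} (a : Fin m → EuclideanSpace ℝ (Fin n)) (b : Fin m → ℝ)
    (x : EuclideanSpace ℝ (Fin n)) (i : Fin m) : ℝ :=
  |(inner ℝ (a i) x) ^ 2 - b i|

/-- The `ℓ₁` objective `F(x) = (1/m) ∑ᵢ |⟨a_i, x⟩² - b_i|`. -/
def objective {n m : ℕ} (a : Fin m → EuclideanSpace ℝ (Fin n)) (b : Fin m → ℝ)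
    (x : EuclideanSpace ℝ (Fin n)) : ℝ :=
  (1 / (m : ℝ)) * ∑ i, absResidual a b x i

/-- The `k`-th order statistic `r_(k)` of `r_1, …, r_m`, for `1 ≤ k ≤ m` (and `0` for other `k`):
the `k`-th entry after sorting in increasing order. -/
def orderStat {m : ℕ} (r : Fin m → ℝ) (k : ℕ) : ℝ :=
  if h : 1 ≤ k ∧ k ≤ m then r (Tuple.sort r ⟨k - 1, by omega⟩) else 0

/-- The `p`-quantile of `r_1, …, r_m`: the order statistic of index `m p`, used when `m p` is
a natural number. -/
def quantile {m : ℕ} (r : Fin m → ℝ) (p : ℝ) : ℝ :=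
  orderStat r ⌊(m : ℝ) * p⌋₊

/-- The data model: the `a_i` are independent with common law `ν`, which has mean `0` and is
`σ²`-subGaussian; the signal `x⋆` is nonzero; the corruptions are nonnegative random variables with
an arbitrary joint distribution, possibly dependent on each other and on the `a_i`. -/
structure DataModel {n m₁ m₂ : ℕ} {Ω : Type*} [MeasurableSpace Ω] (μ : Measure Ω)
    (ν : Measure (EuclideanSpace ℝ (Fin n))) (σ : ℝ≥0)
    (a : Fin (m₁ + m₂) → Ω → EuclideanSpace ℝ (Fin n)) (ξ : Fin m₂ → Ω → ℝ)
    (xs : EuclideanSpace ℝ (Fin n)) : Prop where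
  measurable_a : ∀ i, Measurable (a i)
  law_a : ∀ i, μ.map (a i) = ν
  indep_a : iIndepFun a μ
  mean_zero : ∫ y, y ∂ν = 0
  subGaussian : IsSubGaussian ν σ
  signal_ne_zero : xs ≠ 0
  measurable_xi : ∀ j, Measurable (ξ j)
  xi_nonneg : ∀ j, ∀ᵐ ω ∂μ, 0 ≤ ξ j ω

end

end RobustPhaseRetrieval

open RobustPhaseRetrieval

/-! Put `d = ‖x - x⋆‖ ‖x + x⋆‖` and `D_i = |⟨a_i, x - x⋆⟩ ⟨a_i, x + x⋆⟩|`. A clean residual at `x`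
equals `D_i`. A corrupted residual changes by at most `D_i` between `x⋆` and `x`, whatever its value
`b_i`. Hence both the objective gap and the quantile are comparable to `d`, and so to each other
(`UniformBounds.quantile_mem_Icc`).

The gap is at most the mean of all `D_i`, which is at most `C d`. It is at least the clean sum minus
the corrupted sum, divided by `m`; the expectation of this, relative to `d`, is at least `(1 -
pfail) κst - pfail ‖Σ‖ ≥ κst - 2 pfail ‖Σ‖ > 0`, because `κst ≤ ‖Σ‖`. The quantile is bounded below
by the small-ball condition: more than `(1 - ptil) m` clean samples have `D_i ≥ (κ² / 4) d`. It is
bounded above by Markov's inequality on the clean samples.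

By homogeneity, uniformity in `x` is uniformity over pairs of unit vectors. Chernoff bounds and a
union bound handle a net (`exists_measure_not_goodSample_le`), and `m ≥ ρ₁ n` absorbs its
cardinality. `GoodSample.uniformBounds` passes from the net to the sphere: the sums are Lipschitz,
while the discontinuous count is handled by lowering its threshold. -/

namespace RobustPhaseRetrieval

/-! ### Order statistics and counting. -/

section OrderStat

variable {m : ℕ} (r : Fin m → ℝ) {k : ℕ} {t : ℝ}

/-- If at least `k` of the numbers are at most `t`, then so is the `k`-th smallest. -/
lemma orderStat_le (hk : 1 ≤ k) (h : k ≤ (Finset.univ.filter fun i => r i ≤ t).card) :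
    orderStat r k ≤ t := by
  have hkm : k ≤ m := h.trans ((Finset.card_le_univ _).trans (by simp))
  rw [orderStat, dif_pos ⟨hk, hkm⟩]
  by_contra! hlt
  have hsub : (Finset.univ.filter fun i => r i ≤ t) ⊆
      (Finset.univ.filter fun j : Fin m => (j : ℕ) < k - 1).image (Tuple.sort r) := by
    intro i hi
    rw [Finset.mem_image]
    refine ⟨(Tuple.sort r).symm i, ?_, by simp⟩
    simp only [Finset.mem_filter, Finset.mem_univ, true_and] at hi ⊢
    by_contra! hge
    have := Tuple.monotone_sort r (a := ⟨k - 1, by omega⟩) (b := (Tuple.sort r).symm i) hge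
    simp only [Function.comp_apply, Equiv.apply_symm_apply] at this
    linarith
  have h1 := (Finset.card_le_card hsub).trans Finset.card_image_le
  have h2 : (Finset.univ.filter fun j : Fin m => (j : ℕ) < k - 1).card ≤ k - 1 := by
    rw [Fin.card_filter_val_lt]
    exact min_le_right _ _
  omega

/-- If fewer than `k` of the numbers are below `t`, then the `k`-th smallest is at least `t`. -/
lemma le_orderStat (hk : 1 ≤ k) (hkm : k ≤ m)
    (h : (Finset.univ.filter fun i => r i < t).card < k) : t ≤ orderStat r k := by
  rw [orderStat, dif_pos ⟨hk, hkm⟩]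
  by_contra! hlt
  have hsub : (Finset.univ.filter fun j : Fin m => (j : ℕ) < k).image (Tuple.sort r) ⊆
      Finset.univ.filter fun i => r i < t := by
    intro i hi
    obtain ⟨j, hj, rfl⟩ := Finset.mem_image.1 hi
    simp only [Finset.mem_filter, Finset.mem_univ, true_and] at hj ⊢
    have := Tuple.monotone_sort r (a := j) (b := ⟨k - 1, by omega⟩) (Fin.le_def.2 (by simp; omega))
    simp only [Function.comp_apply] at this
    linarith
  have h1 := Finset.card_le_card hsub
  rw [Finset.card_image_of_injective _ (Tuple.sort r).injective, Fin.card_filter_val_lt,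
    min_eq_right hkm] at h1
  omega

end OrderStat

/-! ### Nets of the unit sphere. -/

section Net

variable {E : Type*} [NormedAddCommGroup E] [NormedSpace ℝ E]

open Metric Module Set in
/-- Volume bound for separated subsets of the unit sphere. -/
lemma card_le_of_separated_sphere [FiniteDimensional ℝ E] {ε : ℝ} (hε : 0 < ε)
    (s : Finset E) (hs : ∀ c ∈ s, ‖c‖ = 1)
    (h : ∀ c ∈ s, ∀ d ∈ s, c ≠ d → ε ≤ ‖c - d‖) :
    (s.card : ℝ) ≤ (1 + 2 / ε) ^ finrank ℝ E := by
  borelize E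
  let μ : Measure E := Measure.addHaar
  have hδ : 0 < ε / 2 := by positivity
  have hρ : 0 < 1 + ε / 2 := by positivity
  have D : Set.Pairwise (s : Set E) (Function.onFun Disjoint fun c => ball (c : E) (ε / 2)) := by
    rintro c hc d hd hcd
    apply ball_disjoint_ball
    rw [dist_eq_norm, add_halves]
    exact h c hc d hd hcd
  have A_subset : (⋃ c ∈ s, ball (c : E) (ε / 2)) ⊆ ball (0 : E) (1 + ε / 2) := by
    refine iUnion₂_subset fun x hx => ball_subset_ball' ?_
    rw [dist_zero_right, hs x hx, add_comm]
  have I : (s.card : ENNReal) * ENNReal.ofReal ((ε / 2) ^ finrank ℝ E) * μ (ball 0 1) ≤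
      ENNReal.ofReal ((1 + ε / 2) ^ finrank ℝ E) * μ (ball 0 1) :=
    calc
      _ = μ (⋃ c ∈ s, ball (c : E) (ε / 2)) := by
        rw [measure_biUnion_finset D fun c _ => measurableSet_ball]
        simp only [μ.addHaar_ball_of_pos _ hδ, Finset.sum_const, nsmul_eq_mul, mul_assoc]
      _ ≤ μ (ball (0 : E) (1 + ε / 2)) := measure_mono A_subset
      _ = _ := by simp only [μ.addHaar_ball_of_pos _ hρ]
  have J := (ENNReal.mul_le_mul_iff_left (measure_ball_pos μ _ zero_lt_one).ne'
    measure_ball_lt_top.ne).1 I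
  have K := ENNReal.toReal_le_of_le_ofReal (pow_nonneg hρ.le _) J
  rw [ENNReal.toReal_mul, ENNReal.toReal_natCast,
    ENNReal.toReal_ofReal (pow_nonneg hδ.le _)] at K
  have h2 : 1 + 2 / ε = (1 + ε / 2) / (ε / 2) := by
    field_simp
    ring
  rw [h2, div_pow, le_div_iff₀ (by positivity)]
  exact K

/-- The unit sphere has an `ε`-net with at most `(1 + 2 / ε) ^ dim E` elements. -/
lemma exists_net_sphere [FiniteDimensional ℝ E] {ε : ℝ} (hε : 0 < ε) :
    ∃ s : Finset E, (∀ c ∈ s, ‖c‖ = 1) ∧ (∀ u : E, ‖u‖ = 1 → ∃ c ∈ s, ‖u - c‖ ≤ ε) ∧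
      (s.card : ℝ) ≤ (1 + 2 / ε) ^ Module.finrank ℝ E := by
  classical
  -- The net is an `ε`-separated set of largest cardinality, which exists by the volume bound; a
  -- point farther than `ε` from it could be added.
  let P : ℕ → Prop := fun N => ∃ s : Finset E, s.card = N ∧ (∀ c ∈ s, ‖c‖ = 1) ∧
    ∀ c ∈ s, ∀ d ∈ s, c ≠ d → ε ≤ ‖c - d‖
  have hP0 : P 0 := ⟨∅, by simp⟩
  have hPle : ∀ N, P N → N ≤ ⌊(1 + 2 / ε) ^ Module.finrank ℝ E⌋₊ := by
    rintro N ⟨s, rfl, hs, h⟩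
    exact Nat.le_floor (card_le_of_separated_sphere hε s hs h)
  obtain ⟨s, hcard, hs, h⟩ := Nat.findGreatest_spec (P := P) (Nat.zero_le _) hP0
  refine ⟨s, hs, fun u hu => ?_, card_le_of_separated_sphere hε s hs h⟩
  by_contra! hfar
  have hus : u ∉ s := fun hmem => by
    have := hfar u hmem
    simp only [sub_self, norm_zero] at this
    linarith
  have hP1 : P (s.card + 1) := by
    refine ⟨insert u s, Finset.card_insert_of_notMem hus, ?_, ?_⟩
    · simpa [hu] using hs
    · intro c hc d hd hcd
      rw [Finset.mem_insert] at hc hd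
      rcases hc with rfl | hc <;> rcases hd with rfl | hd
      · exact absurd rfl hcd
      · exact (hfar d hd).le
      · rw [norm_sub_rev]; exact (hfar c hc).le
      · exact h c hc d hd hcd
  have hgt := (Nat.le_findGreatest (hPle _ hP1) hP1).trans_eq hcard.symm
  exact absurd hgt (by simp)

/-- An operator bounded on a `1/2`-net of the sphere is bounded with twice the constant. -/
lemma opNorm_le_of_net {F : Type*} [NormedAddCommGroup F] [NormedSpace ℝ F] (L : E →L[ℝ] F)
    {s : Set E} (hs : ∀ u : E, ‖u‖ = 1 → ∃ c ∈ s, ‖u - c‖ ≤ 1 / 2) {B : ℝ} (hB : 0 ≤ B)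
    (h : ∀ c ∈ s, ‖L c‖ ≤ B) : ‖L‖ ≤ 2 * B := by
  -- The norm is already known to be finite, so the error `‖L‖ / 2` of the net can be absorbed on
  -- the left.
  suffices ‖L‖ ≤ B + ‖L‖ / 2 by linarith
  refine L.opNorm_le_of_unit_norm (by positivity) fun u hu => ?_
  obtain ⟨c, hc, huc⟩ := hs u hu
  calc ‖L u‖ = ‖L c + L (u - c)‖ := by rw [← map_add, add_sub_cancel]
    _ ≤ ‖L c‖ + ‖L (u - c)‖ := norm_add_le _ _
    _ ≤ B + ‖L‖ * (1 / 2) := by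
        gcongr
        · exact h c hc
        · exact (L.le_opNorm _).trans (by gcongr)
    _ = _ := by ring

end Net

/-! ### Chernoff bounds from an exponential moment. -/

section Chernoff

variable {α : Type*} [MeasurableSpace α] {ν : Measure α} {f : α → ℝ} {l₀ K : ℝ}

lemma exp_le_one_add_add_sq_mul_exp_abs (y : ℝ) :
    Real.exp y ≤ 1 + y + y ^ 2 * Real.exp |y| := by
  have h := Complex.norm_exp_sub_sum_le_norm_mul_exp (y : ℂ) 2
  have h2 : Complex.exp (y : ℂ) - ∑ i ∈ Finset.range 2, (y : ℂ) ^ i / (i.factorial : ℂ)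
      = ((Real.exp y - (1 + y) : ℝ) : ℂ) := by
    simp [Finset.sum_range_succ]
  rw [h2, Complex.norm_real, Complex.norm_real, Real.norm_eq_abs, Real.norm_eq_abs, sq_abs] at h
  linarith [le_abs_self (Real.exp y - (1 + y))]

/-- In the second-order remainder, half of the exponent `l₀ |y|` absorbs the factor `(l y)²` and the
other half absorbs `exp |l y|`; hence the restriction `l ≤ l₀ / 2`. -/
lemma exp_mul_le_of_le_half {l y : ℝ} (hl₀ : 0 < l₀) (hl : 0 ≤ l) (hl2 : l ≤ l₀ / 2) :
    Real.exp (l * y) ≤ 1 + l * y + 8 * l ^ 2 / l₀ ^ 2 * Real.exp (l₀ * |y|) := by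
  refine (exp_le_one_add_add_sq_mul_exp_abs (l * y)).trans ?_
  gcongr 1 + l * y + ?_
  have h1 : (l₀ / 2 * |y|) ^ 2 ≤ 2 * Real.exp (l₀ / 2 * |y|) := by
    have := Real.quadratic_le_exp_of_nonneg (x := l₀ / 2 * |y|) (by positivity)
    nlinarith [show 0 ≤ l₀ / 2 * |y| by positivity]
  have h2 : Real.exp |l * y| ≤ Real.exp (l₀ / 2 * |y|) := by
    rw [abs_mul, abs_of_nonneg hl]
    gcongr
  have h3 : (l * y) ^ 2 = 4 * l ^ 2 / l₀ ^ 2 * (l₀ / 2 * |y|) ^ 2 := by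
    rw [mul_pow, mul_pow, sq_abs]
    field_simp
    ring
  calc (l * y) ^ 2 * Real.exp |l * y|
      ≤ (4 * l ^ 2 / l₀ ^ 2 * (2 * Real.exp (l₀ / 2 * |y|))) * Real.exp (l₀ / 2 * |y|) := by
        rw [h3]; gcongr
    _ = 8 * l ^ 2 / l₀ ^ 2 * (Real.exp (l₀ / 2 * |y|) * Real.exp (l₀ / 2 * |y|)) := by ring
    _ = _ := by rw [← Real.exp_add]; congr 2; ring

lemma integrable_exp_mul_of_le [IsFiniteMeasure ν] {l : ℝ} (hf : Measurable f)
    (hl₀ : l ≤ l₀) (hl : 0 ≤ l)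
    (hint : Integrable (fun y => Real.exp (l₀ * |f y|)) ν) :
    Integrable (fun y => Real.exp (l * f y)) ν := by
  refine hint.mono' (by fun_prop) (ae_of_all _ fun y => ?_)
  rw [Real.norm_eq_abs, Real.abs_exp]
  exact Real.exp_le_exp.2 ((mul_le_mul_of_nonneg_left (le_abs_self _) hl).trans (by gcongr))

lemma integrable_of_integrable_exp_abs (hf : Measurable f) (hl₀ : 0 < l₀)
    (hint : Integrable (fun y => Real.exp (l₀ * |f y|)) ν) : Integrable f ν := by
  refine (hint.const_mul (1 / l₀)).mono' (by fun_prop) (ae_of_all _ fun y => ?_)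
  rw [Real.norm_eq_abs, one_div, ← div_eq_inv_mul, le_div_iff₀ hl₀, mul_comm]
  linarith [Real.add_one_le_exp (l₀ * |f y|)]

lemma mgf_le_exp_of_le_half [IsProbabilityMeasure ν] {l : ℝ} (hf : Measurable f) (hl₀ : 0 < l₀)
    (hl : 0 ≤ l) (hl2 : l ≤ l₀ / 2) (hint : Integrable (fun y => Real.exp (l₀ * |f y|)) ν)
    (hK : ∫ y, Real.exp (l₀ * |f y|) ∂ν ≤ K) :
    mgf f ν l ≤ Real.exp (l * ∫ y, f y ∂ν + 8 * l ^ 2 / l₀ ^ 2 * K) := by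
  have hfi := integrable_of_integrable_exp_abs hf hl₀ hint
  have hi1 : Integrable (fun y => 1 + l * f y) ν := (integrable_const _).add (hfi.const_mul l)
  calc mgf f ν l ≤ ∫ y, (1 + l * f y + 8 * l ^ 2 / l₀ ^ 2 * Real.exp (l₀ * |f y|)) ∂ν :=
        integral_mono (integrable_exp_mul_of_le hf (by linarith) hl hint)
          (hi1.add (hint.const_mul _)) fun y => exp_mul_le_of_le_half hl₀ hl hl2
    _ = 1 + l * ∫ y, f y ∂ν + 8 * l ^ 2 / l₀ ^ 2 * ∫ y, Real.exp (l₀ * |f y|) ∂ν := by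
        rw [integral_add hi1 (hint.const_mul _), integral_add (integrable_const _)
          (hfi.const_mul l), integral_const_mul, integral_const_mul]
        simp
    _ ≤ 1 + l * ∫ y, f y ∂ν + 8 * l ^ 2 / l₀ ^ 2 * K := by gcongr
    _ ≤ _ := by
        linarith [Real.add_one_le_exp (l * ∫ y, f y ∂ν + 8 * l ^ 2 / l₀ ^ 2 * K)]

/-- The Chernoff rate for variables with `𝔼 exp (l₀ |f|) ≤ K` and a deviation `t`. -/
lemma exists_chernoff_parameter (hl₀ : 0 < l₀) (hK : 0 < K) {t : ℝ} (ht : 0 < t) :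
    ∃ l c : ℝ, 0 ≤ l ∧ l ≤ l₀ / 2 ∧ 0 < c ∧ c ≤ l * t - 8 * l ^ 2 / l₀ ^ 2 * K := by
  -- The second entry is where the quadratic term equals `l t / 2`, so half of the linear gain
  -- survives.
  set l := min (l₀ / 2) (t * l₀ ^ 2 / (16 * K)) with hl
  have hlpos : 0 < l := lt_min (by positivity) (by positivity)
  refine ⟨l, l * t / 2, hlpos.le, min_le_left _ _, by positivity, ?_⟩
  have h1 : l ≤ t * l₀ ^ 2 / (16 * K) := min_le_right _ _
  rw [le_div_iff₀ (by positivity)] at h1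
  have h2 : 8 * l ^ 2 / l₀ ^ 2 * K ≤ l * t / 2 := by
    rw [div_mul_eq_mul_div, div_le_iff₀ (by positivity)]
    nlinarith
  linarith

variable {Ω : Type*} [MeasurableSpace Ω] {μ : Measure Ω} [IsProbabilityMeasure μ]
  {ι : Type*} {a : ι → Ω → α}

/-- Chernoff bound for partial sums of i.i.d. variables with an exponential moment. -/
lemma measure_sum_ge_le_exp [IsProbabilityMeasure ν] (ha : ∀ i, Measurable (a i))
    (hlaw : ∀ i, μ.map (a i) = ν) (hind : iIndepFun a μ) {l t c M : ℝ} (hf : Measurable f)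
    (hl₀ : 0 < l₀) (hl : 0 ≤ l) (hl2 : l ≤ l₀ / 2)
    (hint : Integrable (fun y => Real.exp (l₀ * |f y|)) ν)
    (hK : ∫ y, Real.exp (l₀ * |f y|) ∂ν ≤ K)
    (hc : c ≤ l * t - 8 * l ^ 2 / l₀ ^ 2 * K) (s : Finset ι) (hM : (s.card : ℝ) ≤ M) :
    μ.real {ω | (s.card : ℝ) * ∫ y, f y ∂ν + M * t ≤ ∑ i ∈ s, f (a i ω)} ≤ Real.exp (-(M * c)) := by
  have hind' : iIndepFun (fun i ω => f (a i ω)) μ := hind.comp (fun _ => f) fun _ => hf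
  have hmeas : ∀ i, Measurable fun ω => f (a i ω) := fun i => hf.comp (ha i)
  have hinti : ∀ i, Integrable (fun ω => Real.exp (l * f (a i ω))) μ := fun i => by
    have h := integrable_exp_mul_of_le hf (by linarith) hl hint
    rw [← hlaw i] at h
    exact h.comp_measurable (ha i)
  have hmgf : ∀ i, mgf (fun ω => f (a i ω)) μ l = mgf f ν l := fun i => by
    rw [← hlaw i, mgf_map (ha i).aemeasurable (by fun_prop)]
    rfl
  have hsum : mgf (∑ i ∈ s, fun ω => f (a i ω)) μ l = mgf f ν l ^ s.card := by
    rw [hind'.mgf_sum hmeas, Finset.prod_congr rfl fun i _ => hmgf i, Finset.prod_const]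
  have hK0 : 0 ≤ K := le_trans (integral_nonneg fun y => (Real.exp_pos _).le) hK
  have key := measure_ge_le_exp_mul_mgf (μ := μ) (X := ∑ i ∈ s, fun ω => f (a i ω))
    ((s.card : ℝ) * ∫ y, f y ∂ν + M * t) hl (hind'.integrable_exp_mul_sum hmeas fun i _ => hinti i)
  rw [hsum] at key
  simp only [Finset.sum_apply] at key
  refine key.trans ?_
  have h1 : mgf f ν l ^ s.card ≤
      Real.exp (s.card * (l * ∫ y, f y ∂ν + 8 * l ^ 2 / l₀ ^ 2 * K)) := by
    rw [Real.exp_nat_mul]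
    exact pow_le_pow_left₀ mgf_nonneg (mgf_le_exp_of_le_half hf hl₀ hl hl2 hint hK) _
  refine (mul_le_mul_of_nonneg_left h1 (Real.exp_pos _).le).trans ?_
  rw [← Real.exp_add, Real.exp_le_exp]
  have hM0 : 0 ≤ M := (Nat.cast_nonneg _).trans hM
  -- The deviation is measured against `M` rather than `s.card`, so a single rate serves the clean,
  -- the corrupted and the full sample.
  have h2 : (s.card : ℝ) * (8 * l ^ 2 / l₀ ^ 2 * K) ≤ M * (8 * l ^ 2 / l₀ ^ 2 * K) := by gcongr
  have h3 := mul_le_mul_of_nonneg_left hc hM0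
  linarith

end Chernoff

/-! ### Moments of sub-Gaussian laws. -/

section SubGaussian

/-- The exponential moment of the square of a sub-Gaussian variable, by Gaussian linearization. -/
lemma lintegral_exp_sq_le {α : Type*} [MeasurableSpace α] {ν : Measure α}
    [IsProbabilityMeasure ν] {X : α → ℝ} (hX : Measurable X) {c : ℝ≥0}
    (h : HasSubgaussianMGF X c ν) {l : ℝ} (hl : 0 ≤ l) (hcl : c * l ≤ 1 / 4) :
    ∫⁻ y, ENNReal.ofReal (Real.exp (l * X y ^ 2)) ∂ν ≤
      ∫⁻ g, ENNReal.ofReal (Real.exp (g ^ 2 / 4)) ∂(gaussianReal 0 1) := by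
  -- An auxiliary standard Gaussian `g` makes the exponent linear in `X`. After Tonelli, the
  -- sub-Gaussian bound at `√(2 l) g` gives `exp (c l g²) ≤ exp (g² / 4)`.
  have h1 : ∀ y, ENNReal.ofReal (Real.exp (l * X y ^ 2)) =
      ∫⁻ g, ENNReal.ofReal (Real.exp (√(2 * l) * X y * g)) ∂(gaussianReal 0 1) := fun y => by
    rw [← ofReal_integral_eq_lintegral_ofReal]
    · have := mgf_gaussianReal (p := gaussianReal 0 1) (X := id) (μ := 0) (v := 1) (by simp)
        (√(2 * l) * X y)
      simp only [mgf, id] at this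
      rw [this, mul_pow, Real.sq_sqrt (by positivity)]
      congr 2
      simp
      ring
    · exact integrable_exp_mul_gaussianReal _
    · exact ae_of_all _ fun g => (Real.exp_pos _).le
  simp_rw [h1]
  rw [lintegral_lintegral_swap (by fun_prop)]
  refine lintegral_mono fun g => ?_
  have h2 : ∀ y, √(2 * l) * X y * g = (√(2 * l) * g) * X y := fun y => by ring
  simp_rw [h2]
  rw [← ofReal_integral_eq_lintegral_ofReal (h.integrable_exp_mul _)
    (ae_of_all _ fun g => (Real.exp_pos _).le)]
  refine ENNReal.ofReal_le_ofReal ((h.mgf_le _).trans (Real.exp_le_exp.2 ?_))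
  rw [mul_pow, Real.sq_sqrt (by positivity)]
  nlinarith [sq_nonneg g]

lemma lintegral_exp_sq_gaussianReal_lt_top :
    ∫⁻ g, ENNReal.ofReal (Real.exp (g ^ 2 / 4)) ∂(gaussianReal 0 1) < ⊤ := by
  rw [gaussianReal_of_var_ne_zero _ one_ne_zero,
    lintegral_withDensity_eq_lintegral_mul _ (measurable_gaussianPDF _ _) (by fun_prop)]
  have h : Integrable (fun x : ℝ => (√(2 * Real.pi))⁻¹ * Real.exp (-(1 / 4) * x ^ 2)) :=
    (integrable_exp_neg_mul_sq (by norm_num)).const_mul _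
  refine lt_of_eq_of_lt (lintegral_congr fun x => ?_) h.lintegral_lt_top
  simp only [Pi.mul_apply, gaussianPDF, gaussianPDFReal]
  rw [← ENNReal.ofReal_mul (by positivity), mul_assoc, ← Real.exp_add]
  simp
  ring_nf

/-- Uniform exponential moment of the products `⟨a, u⟩ ⟨a, v⟩`. -/
lemma exists_exp_moment_inner_mul_inner (σ : ℝ≥0) :
    ∃ l₀ K : ℝ, 0 < l₀ ∧ 0 < K ∧ ∀ (n : ℕ) (ν : Measure (EuclideanSpace ℝ (Fin n)))
      [IsProbabilityMeasure ν], IsSubGaussian ν σ → ∀ u v, ‖u‖ = 1 → ‖v‖ = 1 →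
      Integrable (fun y => Real.exp (l₀ * |inner ℝ y u * inner ℝ y v|)) ν ∧
      ∫ y, Real.exp (l₀ * |inner ℝ y u * inner ℝ y v|) ∂ν ≤ K := by
  set G := ∫⁻ g, ENNReal.ofReal (Real.exp (g ^ 2 / 4)) ∂(gaussianReal 0 1) with hG
  have hGt : G < ⊤ := lintegral_exp_sq_gaussianReal_lt_top
  -- This `l₀` satisfies `σ² l₀ ≤ 1 / 4` even for `σ = 0`. Since `|s t|` is at most the larger of
  -- `s²` and `t²`, its exponential is at most the sum of theirs, whence `G + G`.
  refine ⟨1 / (4 * (σ ^ 2 + 1)), G.toReal + G.toReal + 1, by positivity, by positivity, ?_⟩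
  intro n ν _ hν u v hu hv
  set l : ℝ := 1 / (4 * (σ ^ 2 + 1)) with hl
  have hl0 : 0 < l := by positivity
  have hsq : ∀ u : EuclideanSpace ℝ (Fin n), ‖u‖ = 1 →
      ∫⁻ y, ENNReal.ofReal (Real.exp (l * (inner ℝ y u : ℝ) ^ 2)) ∂ν ≤ G := by
    intro u hu
    have hs := hν u
    rw [show ‖u‖₊ = 1 from NNReal.eq hu] at hs
    have := lintegral_exp_sq_le (by fun_prop) hs hl0.le (by
      simp only [one_pow, mul_one, NNReal.coe_pow]
      rw [hl, mul_one_div, div_le_div_iff₀ (by positivity) (by norm_num)]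
      linarith)
    simpa only [real_inner_comm] using this
  have hpt : ∀ y, ENNReal.ofReal (Real.exp (l * |(inner ℝ y u : ℝ) * inner ℝ y v|)) ≤
      ENNReal.ofReal (Real.exp (l * (inner ℝ y u : ℝ) ^ 2)) +
      ENNReal.ofReal (Real.exp (l * (inner ℝ y v : ℝ) ^ 2)) := by
    intro y
    rw [← ENNReal.ofReal_add (by positivity) (by positivity)]
    refine ENNReal.ofReal_le_ofReal ?_
    rw [abs_mul, ← sq_abs (inner ℝ y u : ℝ), ← sq_abs (inner ℝ y v : ℝ)]
    rcases le_total |(inner ℝ y u : ℝ)| |(inner ℝ y v : ℝ)| with h | h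
    · have : |(inner ℝ y u : ℝ)| * |(inner ℝ y v : ℝ)| ≤ |(inner ℝ y v : ℝ)| ^ 2 := by
        rw [sq]; gcongr
      have := Real.exp_le_exp.2 (mul_le_mul_of_nonneg_left this hl0.le)
      linarith [Real.exp_pos (l * |(inner ℝ y u : ℝ)| ^ 2)]
    · have : |(inner ℝ y u : ℝ)| * |(inner ℝ y v : ℝ)| ≤ |(inner ℝ y u : ℝ)| ^ 2 := by
        rw [sq]; gcongr
      have := Real.exp_le_exp.2 (mul_le_mul_of_nonneg_left this hl0.le)
      linarith [Real.exp_pos (l * |(inner ℝ y v : ℝ)| ^ 2)]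
  have hle : ∫⁻ y, ENNReal.ofReal (Real.exp (l * |(inner ℝ y u : ℝ) * inner ℝ y v|)) ∂ν ≤ G + G := by
    refine (lintegral_mono hpt).trans ?_
    rw [lintegral_add_left (by fun_prop)]
    exact add_le_add (hsq u hu) (hsq v hv)
  have hmeas : AEStronglyMeasurable
      (fun y => Real.exp (l * |(inner ℝ y u : ℝ) * inner ℝ y v|)) ν := by fun_prop
  refine ⟨⟨hmeas, ?_⟩, ?_⟩
  · rw [hasFiniteIntegral_iff_ofReal (ae_of_all _ fun y => (Real.exp_pos _).le)]
    exact hle.trans_lt (ENNReal.add_lt_top.2 ⟨hGt, hGt⟩)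
  · rw [integral_eq_lintegral_of_nonneg_ae (ae_of_all _ fun y => (Real.exp_pos _).le) hmeas]
    have := ENNReal.toReal_mono (ENNReal.add_lt_top.2 ⟨hGt, hGt⟩).ne hle
    rw [ENNReal.toReal_add hGt.ne hGt.ne] at this
    linarith

variable {n : ℕ} {ν : Measure (EuclideanSpace ℝ (Fin n))} {σ : ℝ≥0}

lemma IsSubGaussian.memLp_inner (hν : IsSubGaussian ν σ) (u : EuclideanSpace ℝ (Fin n)) :
    MemLp (fun y => inner ℝ y u : EuclideanSpace ℝ (Fin n) → ℝ) 2 ν := by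
  simpa only [real_inner_comm, ENNReal.coe_ofNat] using (hν u).memLp 2

lemma IsSubGaussian.integrable_abs_inner_mul_inner (hν : IsSubGaussian ν σ)
    (u v : EuclideanSpace ℝ (Fin n)) :
    Integrable (fun y => |(inner ℝ y u : ℝ) * inner ℝ y v|) ν :=
  ((hν.memLp_inner u).integrable_mul (hν.memLp_inner v)).abs

/-- The second moment in a unit direction is at most the spectral norm of the covariance. -/
lemma integral_inner_sq_le [IsProbabilityMeasure ν] (hν : IsSubGaussian ν σ)
    (hmean : ∫ y, y ∂ν = 0) {u : EuclideanSpace ℝ (Fin n)} (hu : ‖u‖ = 1) :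
    ∫ y, (inner ℝ y u : ℝ) ^ 2 ∂ν ≤ specNorm (covarianceMatrix ν) := by
  have hcoord : ∀ i : Fin n, MemLp (fun y : EuclideanSpace ℝ (Fin n) => y i) 2 ν := fun i => by
    simpa [EuclideanSpace.inner_single_right] using hν.memLp_inner (EuclideanSpace.single i 1)
  have hzero : ∀ i : Fin n, ∫ y : EuclideanSpace ℝ (Fin n), y i ∂ν = 0 := fun i => by
    have hint : Integrable (fun y : EuclideanSpace ℝ (Fin n) => y) ν := by
      have : MemLp (fun y : EuclideanSpace ℝ (Fin n) => y) 2 ν :=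
        (memLp_piLp_iff).2 hcoord
      exact this.integrable (by norm_num)
    have := (EuclideanSpace.proj (𝕜 := ℝ) i).integral_comp_comm hint
    simpa [hmean] using this
  have hcov : ∀ i j, covarianceMatrix ν i j = ∫ y : EuclideanSpace ℝ (Fin n), y i * y j ∂ν := by
    intro i j
    simp [covarianceMatrix, covariance, hzero]
  -- As the mean vanishes, the second moment is the quadratic form of `Σ` at `u`.
  have hexp : ∫ y, (inner ℝ y u : ℝ) ^ 2 ∂ν =
      inner ℝ u (Matrix.toEuclideanCLM (n := Fin n) (𝕜 := ℝ) (covarianceMatrix ν) u) := by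
    have h1 : ∀ y : EuclideanSpace ℝ (Fin n), (inner ℝ y u : ℝ) ^ 2 =
        ∑ i, ∑ j, u i * u j * (y i * y j) := fun y => by
      rw [PiLp.inner_apply, sq, Finset.sum_mul_sum]
      refine Finset.sum_congr rfl fun i _ => Finset.sum_congr rfl fun j _ => ?_
      simp
      ring
    have hij : ∀ i j, Integrable (fun y : EuclideanSpace ℝ (Fin n) => u i * u j * (y i * y j)) ν :=
      fun i j => ((hcoord i).integrable_mul (hcoord j)).const_mul _
    simp_rw [h1]
    rw [integral_finsetSum _ fun i _ => integrable_finsetSum _ fun j _ => hij i j]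
    simp_rw [integral_finsetSum _ fun j _ => hij _ j, integral_const_mul, ← hcov]
    rw [PiLp.inner_apply]
    refine Finset.sum_congr rfl fun i _ => ?_
    simp [Matrix.mulVec, dotProduct, Finset.sum_mul]
    refine Finset.sum_congr rfl fun j _ => ?_
    ring
  rw [hexp]
  refine (real_inner_le_norm _ _).trans ?_
  rw [hu, one_mul]
  simpa [hu, specNorm] using (Matrix.toEuclideanCLM (n := Fin n) (𝕜 := ℝ) (covarianceMatrix ν)).le_opNorm u

/-- The first absolute moment of `⟨a, u⟩ ⟨a, v⟩` for unit vectors is at most the spectral norm. -/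
lemma integral_abs_inner_mul_inner_le [IsProbabilityMeasure ν] (hν : IsSubGaussian ν σ)
    (hmean : ∫ y, y ∂ν = 0) {u v : EuclideanSpace ℝ (Fin n)} (hu : ‖u‖ = 1) (hv : ‖v‖ = 1) :
    ∫ y, |(inner ℝ y u : ℝ) * inner ℝ y v| ∂ν ≤ specNorm (covarianceMatrix ν) := by
  have hi := fun w => (hν.memLp_inner w).integrable_sq
  calc ∫ y, |(inner ℝ y u : ℝ) * inner ℝ y v| ∂ν
      ≤ ∫ y, (1 / 2 * (inner ℝ y u : ℝ) ^ 2 + 1 / 2 * (inner ℝ y v : ℝ) ^ 2) ∂ν := by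
        refine integral_mono (hν.integrable_abs_inner_mul_inner u v)
          (((hi u).const_mul _).add ((hi v).const_mul _)) fun y => ?_
        simp only [abs_mul]
        nlinarith [sq_nonneg (|(inner ℝ y u : ℝ)| - |(inner ℝ y v : ℝ)|),
          sq_abs (inner ℝ y u : ℝ), sq_abs (inner ℝ y v : ℝ)]
    _ = 1 / 2 * ∫ y, (inner ℝ y u : ℝ) ^ 2 ∂ν + 1 / 2 * ∫ y, (inner ℝ y v : ℝ) ^ 2 ∂ν := by
        rw [integral_add ((hi u).const_mul _) ((hi v).const_mul _), integral_const_mul,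
          integral_const_mul]
    _ ≤ _ := by linarith [integral_inner_sq_le hν hmean hu, integral_inner_sq_le hν hmean hv]

/-- A real `⨅` lies below its terms only for families bounded below; nonnegativity supplies this at
both levels. -/
lemma iInf_iInf_le_of_nonneg {α β : Type*} {f : α → β → ℝ} (hf : ∀ a b, 0 ≤ f a b) (a : α)
    (b : β) : ⨅ a, ⨅ b, f a b ≤ f a b :=
  (ciInf_le ⟨0, Set.forall_mem_range.2 fun a => Real.iInf_nonneg (hf a)⟩ a).trans
    (ciInf_le ⟨0, Set.forall_mem_range.2 (hf a)⟩ b)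

lemma kappaSt_le {u v : EuclideanSpace ℝ (Fin n)} (hu : ‖u‖ = 1) (hv : ‖v‖ = 1) :
    kappaSt ν ≤ ∫ y, |(inner ℝ y u : ℝ) * inner ℝ y v| ∂ν :=
  iInf_iInf_le_of_nonneg (f := fun u v : Metric.sphere (0 : EuclideanSpace ℝ (Fin n)) 1 =>
      ∫ y, |(inner ℝ y (u : EuclideanSpace ℝ (Fin n)) : ℝ) * inner ℝ y (v : EuclideanSpace ℝ (Fin n))| ∂ν)
    (fun _ _ => integral_nonneg fun _ => abs_nonneg _) ⟨u, by simpa using hu⟩ ⟨v, by simpa using hv⟩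

lemma smallBallProb_le {κ : ℝ} {u v : EuclideanSpace ℝ (Fin n)} (hu : ‖u‖ = 1) (hv : ‖v‖ = 1) :
    smallBallProb ν κ ≤ ν.real {y | κ ≤ min |(inner ℝ y u : ℝ)| |(inner ℝ y v : ℝ)|} :=
  iInf_iInf_le_of_nonneg (f := fun u v : Metric.sphere (0 : EuclideanSpace ℝ (Fin n)) 1 =>
      ν.real {y | κ ≤ min |(inner ℝ y (u : EuclideanSpace ℝ (Fin n)) : ℝ)|
        |(inner ℝ y (v : EuclideanSpace ℝ (Fin n)) : ℝ)|})
    (fun _ _ => measureReal_nonneg) ⟨u, by simpa using hu⟩ ⟨v, by simpa using hv⟩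

end SubGaussian

/-! ### Deterministic estimates for a fixed sample. -/

section Deterministic

/-- Markov's inequality for the counting measure. -/
lemma card_filter_mul_le_sum {ι : Type*} (s : Finset ι) {f : ι → ℝ} (hf : ∀ i, 0 ≤ f i) (h : ℝ) :
    ((s.filter fun i => h ≤ f i).card : ℝ) * h ≤ ∑ i ∈ s, f i := by
  rw [← nsmul_eq_mul]
  refine (Finset.card_nsmul_le_sum _ f h fun i hi => (Finset.mem_filter.1 hi).2).trans ?_
  exact Finset.sum_le_sum_of_subset_of_nonneg (Finset.filter_subset _ _) fun i _ _ => hf i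

variable {n m : ℕ} (A : Fin m → EuclideanSpace ℝ (Fin n))

/-- The sampling operator `u ↦ (⟨a_i, u⟩)_i`. -/
noncomputable def samplingCLM : EuclideanSpace ℝ (Fin n) →L[ℝ] EuclideanSpace ℝ (Fin m) :=
  LinearMap.toContinuousLinearMap
    { toFun := fun u => WithLp.toLp 2 fun i => (inner ℝ (A i) u : ℝ)
      map_add' := fun u v => by ext i; simp [inner_add_right]
      map_smul' := fun c u => by ext i; simp [inner_smul_right] }

lemma norm_samplingCLM_sq (u : EuclideanSpace ℝ (Fin n)) :
    ‖samplingCLM A u‖ ^ 2 = ∑ i, (inner ℝ (A i) u : ℝ) ^ 2 := by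
  rw [EuclideanSpace.norm_sq_eq]
  simp [samplingCLM]

variable {A}

/-- A bound on `∑ ⟨a_i, u⟩²` over a net of the sphere extends to all `u`. -/
lemma sum_inner_sq_le_of_net {s : Set (EuclideanSpace ℝ (Fin n))}
    (hs : ∀ u : EuclideanSpace ℝ (Fin n), ‖u‖ = 1 → ∃ c ∈ s, ‖u - c‖ ≤ 1 / 2) {C : ℝ} (hC : 0 ≤ C)
    (h : ∀ c ∈ s, ∑ i, (inner ℝ (A i) c : ℝ) ^ 2 ≤ C) (u : EuclideanSpace ℝ (Fin n)) :
    ∑ i, (inner ℝ (A i) u : ℝ) ^ 2 ≤ 4 * C * ‖u‖ ^ 2 := by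
  have hL := opNorm_le_of_net (samplingCLM A) hs (Real.sqrt_nonneg C) fun c hc => by
    refine Real.le_sqrt_of_sq_le ?_
    rw [norm_samplingCLM_sq]
    exact h c hc
  rw [← norm_samplingCLM_sq]
  calc ‖samplingCLM A u‖ ^ 2 ≤ (2 * √C * ‖u‖) ^ 2 := by
        gcongr
        exact (ContinuousLinearMap.le_opNorm _ _).trans (by gcongr)
    _ = 4 * C * ‖u‖ ^ 2 := by rw [mul_pow, mul_pow, Real.sq_sqrt hC]; ring

lemma sum_abs_inner_mul_inner_le {C : ℝ} (hC : 0 ≤ C)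
    (hA : ∀ u, ∑ i, (inner ℝ (A i) u : ℝ) ^ 2 ≤ C * ‖u‖ ^ 2) (I : Finset (Fin m))
    (u v : EuclideanSpace ℝ (Fin n)) :
    ∑ i ∈ I, |(inner ℝ (A i) u : ℝ) * inner ℝ (A i) v| ≤ C * ‖u‖ * ‖v‖ := by
  have hI : ∀ u, ∑ i ∈ I, |(inner ℝ (A i) u : ℝ)| ^ 2 ≤ C * ‖u‖ ^ 2 := fun u => by
    simp_rw [sq_abs]
    exact (Finset.sum_le_univ_sum_of_nonneg fun i => sq_nonneg _).trans (hA u)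
  refine le_of_sq_le_sq ?_ (by positivity)
  simp_rw [abs_mul]
  calc (∑ i ∈ I, |(inner ℝ (A i) u : ℝ)| * |(inner ℝ (A i) v : ℝ)|) ^ 2
      ≤ (∑ i ∈ I, |(inner ℝ (A i) u : ℝ)| ^ 2) * ∑ i ∈ I, |(inner ℝ (A i) v : ℝ)| ^ 2 :=
        Finset.sum_mul_sq_le_sq_mul_sq _ _ _
    _ ≤ (C * ‖u‖ ^ 2) * (C * ‖v‖ ^ 2) :=
        mul_le_mul (hI u) (hI v) (Finset.sum_nonneg fun i _ => sq_nonneg _) (by positivity)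
    _ = (C * ‖u‖ * ‖v‖) ^ 2 := by ring

/-- The sums `∑ |⟨a_i, u⟩ ⟨a_i, v⟩|` are Lipschitz in `(u, v)` on the sphere. -/
lemma abs_sum_abs_inner_mul_inner_sub_le {C ε : ℝ} (hC : 0 ≤ C)
    (hA : ∀ u, ∑ i, (inner ℝ (A i) u : ℝ) ^ 2 ≤ C * ‖u‖ ^ 2) (I : Finset (Fin m))
    {u v u' v' : EuclideanSpace ℝ (Fin n)} (hv : ‖v‖ = 1) (hu' : ‖u'‖ = 1)
    (huu' : ‖u - u'‖ ≤ ε) (hvv' : ‖v - v'‖ ≤ ε) :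
    |(∑ i ∈ I, |(inner ℝ (A i) u : ℝ) * inner ℝ (A i) v|) -
      (∑ i ∈ I, |(inner ℝ (A i) u' : ℝ) * inner ℝ (A i) v'|)| ≤ 2 * C * ε := by
  rw [← Finset.sum_sub_distrib]
  calc _ ≤ ∑ i ∈ I, |(|(inner ℝ (A i) u : ℝ) * inner ℝ (A i) v| -
          |(inner ℝ (A i) u' : ℝ) * inner ℝ (A i) v'|)| := Finset.abs_sum_le_sum_abs _ _
    _ ≤ ∑ i ∈ I, (|(inner ℝ (A i) (u - u') : ℝ) * inner ℝ (A i) v| +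
          |(inner ℝ (A i) u' : ℝ) * inner ℝ (A i) (v - v')|) := by
        refine Finset.sum_le_sum fun i _ => ?_
        -- Telescoping: `⟨u⟩⟨v⟩ - ⟨u'⟩⟨v'⟩ = ⟨u - u'⟩⟨v⟩ + ⟨u'⟩⟨v - v'⟩`.
        refine (abs_abs_sub_abs_le _ _).trans ?_
        refine le_trans (le_of_eq ?_) (abs_add_le _ _)
        rw [inner_sub_right, inner_sub_right]
        ring_nf
    _ ≤ C * ‖u - u'‖ * ‖v‖ + C * ‖u'‖ * ‖v - v'‖ := by
        rw [Finset.sum_add_distrib]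
        exact add_le_add (sum_abs_inner_mul_inner_le hC hA I _ _)
          (sum_abs_inner_mul_inner_le hC hA I _ _)
    _ ≤ C * ε * 1 + C * 1 * ε := by rw [hv, hu']; gcongr
    _ = _ := by ring

/-- Stability of the small-ball count under perturbations of the directions. -/
lemma card_filter_min_le {C ε κ : ℝ} (hκ : 0 < κ)
    (hA : ∀ u, ∑ i, (inner ℝ (A i) u : ℝ) ^ 2 ≤ C * ‖u‖ ^ 2) (hC : 0 ≤ C) (G : Finset (Fin m))
    {u v u' v' : EuclideanSpace ℝ (Fin n)} (huu' : ‖u - u'‖ ≤ ε) (hvv' : ‖v - v'‖ ≤ ε) :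
    ((G.filter fun i => κ ≤ min |(inner ℝ (A i) u' : ℝ)| |(inner ℝ (A i) v' : ℝ)|).card : ℝ) ≤
      (G.filter fun i => κ ^ 2 / 4 ≤ |(inner ℝ (A i) u : ℝ) * inner ℝ (A i) v|).card +
        8 * C * ε ^ 2 / κ ^ 2 := by
  classical
  have hbad : ∀ w : EuclideanSpace ℝ (Fin n), ‖w‖ ≤ ε →
      ((G.filter fun i => κ ^ 2 / 4 ≤ (inner ℝ (A i) w : ℝ) ^ 2).card : ℝ) ≤
        4 * C * ε ^ 2 / κ ^ 2 := fun w hw => by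
    have h1 := card_filter_mul_le_sum G (f := fun i => (inner ℝ (A i) w : ℝ) ^ 2)
      (fun i => sq_nonneg _) (κ ^ 2 / 4)
    have h2 : ∑ i ∈ G, (inner ℝ (A i) w : ℝ) ^ 2 ≤ C * ε ^ 2 :=
      ((Finset.sum_le_univ_sum_of_nonneg fun i => sq_nonneg _).trans (hA w)).trans (by gcongr)
    rw [le_div_iff₀ (by positivity)]
    linarith
  -- Unless one of the perturbations reaches `κ / 2`, both inner products stay at least `κ / 2`.
  -- Markov's inequality bounds the number of exceptions for each direction by `4 C ε² / κ²`.
  have hsub : (G.filter fun i => κ ≤ min |(inner ℝ (A i) u' : ℝ)| |(inner ℝ (A i) v' : ℝ)|) ⊆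
      (G.filter fun i => κ ^ 2 / 4 ≤ |(inner ℝ (A i) u : ℝ) * inner ℝ (A i) v|) ∪
      ((G.filter fun i => κ ^ 2 / 4 ≤ (inner ℝ (A i) (u - u') : ℝ) ^ 2) ∪
        (G.filter fun i => κ ^ 2 / 4 ≤ (inner ℝ (A i) (v - v') : ℝ) ^ 2)) := by
    intro i hi
    simp only [Finset.mem_filter, Finset.mem_union, le_min_iff] at hi ⊢
    obtain ⟨hiG, h1, h2⟩ := hi
    by_contra! hcon
    obtain ⟨c1, c2, c3⟩ := hcon
    have hhalf : κ ^ 2 / 4 = (κ / 2) ^ 2 := by ring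
    have key : ∀ w w' : EuclideanSpace ℝ (Fin n), κ ≤ |(inner ℝ (A i) w' : ℝ)| →
        (inner ℝ (A i) (w - w') : ℝ) ^ 2 < κ ^ 2 / 4 → κ / 2 ≤ |(inner ℝ (A i) w : ℝ)| := by
      intro w w' h h'
      rw [hhalf] at h'
      have h3 := abs_lt_of_sq_lt_sq h' (by positivity)
      rw [inner_sub_right] at h3
      have h4 := abs_sub_abs_le_abs_sub (inner ℝ (A i) w' : ℝ) (inner ℝ (A i) w)
      rw [abs_sub_comm] at h4
      linarith
    have hu := key u u' h1 (c2 hiG)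
    have hv := key v v' h2 (c3 hiG)
    have := c1 hiG
    rw [abs_mul, hhalf, sq] at this
    exact absurd (mul_le_mul hu hv (by positivity) (abs_nonneg _)) (not_le.2 this)
  have hcard := (Finset.card_le_card hsub).trans
    ((Finset.card_union_le _ _).trans (Nat.add_le_add_left (Finset.card_union_le _ _) _))
  have hcard' : ((G.filter fun i =>
      κ ≤ min |(inner ℝ (A i) u' : ℝ)| |(inner ℝ (A i) v' : ℝ)|).card : ℝ) ≤ _ :=
    Nat.cast_le.2 hcard
  push_cast at hcard'
  have e : 8 * C * ε ^ 2 / κ ^ 2 = 4 * C * ε ^ 2 / κ ^ 2 + 4 * C * ε ^ 2 / κ ^ 2 := by ring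
  linarith [hbad _ huu', hbad _ hvv']

/-- Deviation estimates over a finite set `s` of directions; `G` is the set of clean samples. -/
structure GoodSample (A : Fin m → EuclideanSpace ℝ (Fin n)) (G : Finset (Fin m))
    (S κst κ p₀ t : ℝ) (s : Finset (EuclideanSpace ℝ (Fin n))) : Prop where
  clean : ∀ u ∈ s, ∀ v ∈ s,
    (G.card : ℝ) * κst - m * t ≤ ∑ i ∈ G, |(inner ℝ (A i) u : ℝ) * inner ℝ (A i) v|
  corrupted : ∀ u ∈ s, ∀ v ∈ s,
    ∑ i ∈ Gᶜ, |(inner ℝ (A i) u : ℝ) * inner ℝ (A i) v| ≤ (Gᶜ.card : ℝ) * S + m * t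
  square : ∀ u ∈ s, ∑ i, (inner ℝ (A i) u : ℝ) ^ 2 ≤ m * S + m * t
  smallBall : ∀ u ∈ s, ∀ v ∈ s, (G.card : ℝ) * p₀ - m * t ≤
    (G.filter fun i => κ ≤ min |(inner ℝ (A i) u : ℝ)| |(inner ℝ (A i) v : ℝ)|).card

/-- Uniform estimates, homogeneous in both directions. -/
structure UniformBounds (A : Fin m → EuclideanSpace ℝ (Fin n)) (G : Finset (Fin m))
    (g C h q : ℝ) : Prop where
  sharp : ∀ w z, m * g * (‖w‖ * ‖z‖) ≤ ∑ i ∈ G, |(inner ℝ (A i) w : ℝ) * inner ℝ (A i) z| -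
    ∑ i ∈ Gᶜ, |(inner ℝ (A i) w : ℝ) * inner ℝ (A i) z|
  upper : ∀ w z (I : Finset (Fin m)),
    ∑ i ∈ I, |(inner ℝ (A i) w : ℝ) * inner ℝ (A i) z| ≤ m * C * (‖w‖ * ‖z‖)
  count : ∀ w z, m * q <
    (G.filter fun i => h * (‖w‖ * ‖z‖) ≤ |(inner ℝ (A i) w : ℝ) * inner ℝ (A i) z|).card

/-- Approximation by net points, then scaling. Per sample, the sharpness bound loses `2 t` by
deviation and `4 C ε` by the Lipschitz estimate, half of each for the clean sum and half for the
corrupted sum. The value of `C` comes from the operator norm bound on a `1 / 2`-net. -/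
lemma GoodSample.uniformBounds {G : Finset (Fin m)} {S κst κ p₀ pfail q t C ε g : ℝ}
    {s : Finset (EuclideanSpace ℝ (Fin n))} (hm : 0 < m)
    (h : GoodSample A G S κst κ p₀ t s) (hs1 : ∀ c ∈ s, ‖c‖ = 1)
    (hs : ∀ u : EuclideanSpace ℝ (Fin n), ‖u‖ = 1 → ∃ c ∈ s, ‖u - c‖ ≤ ε)
    (hε : ε ≤ 1 / 2) (hκ : 0 < κ) (hSt : 0 ≤ S + t) (hC : C = 4 * (S + t))
    (hG : (G.card : ℝ) = (1 - pfail) * m) (hGc : (Gᶜ.card : ℝ) = pfail * m)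
    (hg : g + 2 * t + 4 * C * ε ≤ (1 - pfail) * κst - pfail * S)
    (hq : q + t + 8 * C * ε ^ 2 / κ ^ 2 < (1 - pfail) * p₀) (hq1 : q < 1 - pfail) :
    UniformBounds A G g C (κ ^ 2 / 4) q := by
  have hm' : (0 : ℝ) < m := Nat.cast_pos.2 hm
  have hC0 : 0 ≤ C := by rw [hC]; positivity
  have hA : ∀ u, ∑ i, (inner ℝ (A i) u : ℝ) ^ 2 ≤ m * C * ‖u‖ ^ 2 := fun u => by
    have := sum_inner_sq_le_of_net (A := A) (s := (s : Set (EuclideanSpace ℝ (Fin n))))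
      (C := m * (S + t)) (fun u hu => by
        obtain ⟨c, hc, hcu⟩ := hs u hu
        exact ⟨c, hc, hcu.trans hε⟩) (by positivity)
      (fun c hc => by rw [mul_add]; exact h.square c hc) u
    rw [hC]
    linarith
  have hmC : 0 ≤ m * C := by positivity
  have scale : ∀ (w z : EuclideanSpace ℝ (Fin n)) (i : Fin m), w ≠ 0 → z ≠ 0 →
      |(inner ℝ (A i) w : ℝ) * inner ℝ (A i) z| = (‖w‖ * ‖z‖) *
        |(inner ℝ (A i) (‖w‖⁻¹ • w) : ℝ) * inner ℝ (A i) (‖z‖⁻¹ • z)| := by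
    intro w z i hw hz
    have hw' := norm_ne_zero_iff.2 hw
    have hz' := norm_ne_zero_iff.2 hz
    rw [inner_smul_right, inner_smul_right]
    conv_rhs => rw [← abs_of_nonneg (show 0 ≤ ‖w‖ * ‖z‖ by positivity), ← abs_mul]
    congr 1
    field_simp
  refine ⟨fun w z => ?_, fun w z I => ?_, fun w z => ?_⟩
  · by_cases hw : w = 0
    · simp [hw]
    by_cases hz : z = 0
    · simp [hz]
    simp_rw [scale w z _ hw hz]
    rw [← Finset.mul_sum, ← Finset.mul_sum, ← mul_sub, mul_comm]
    refine mul_le_mul_of_nonneg_left ?_ (by positivity)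
    have hu := norm_smul_inv_norm (𝕜 := ℝ) hw
    have hv := norm_smul_inv_norm (𝕜 := ℝ) hz
    simp only [RCLike.ofReal_real_eq_id, id] at hu hv
    obtain ⟨u', hu's, huu'⟩ := hs _ hu
    obtain ⟨v', hv's, hvv'⟩ := hs _ hv
    have h1 := (abs_le.1 (abs_sum_abs_inner_mul_inner_sub_le hmC hA G hv (hs1 u' hu's) huu' hvv')).1
    have h2 := (abs_le.1 (abs_sum_abs_inner_mul_inner_sub_le hmC hA Gᶜ hv (hs1 u' hu's) huu' hvv')).2
    have h3 := h.clean u' hu's v' hv's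
    have h4 := h.corrupted u' hu's v' hv's
    rw [hG] at h3
    rw [hGc] at h4
    have h5 := mul_le_mul_of_nonneg_left hg hm'.le
    linarith
  · exact (sum_abs_inner_mul_inner_le hmC hA I w z).trans_eq (by ring)
  -- For a zero vector the threshold is zero and every clean index counts, so `q < 1 - pfail`
  -- suffices.
  · have htriv : ‖w‖ * ‖z‖ = 0 → m * q < ((G.filter fun i => κ ^ 2 / 4 * (‖w‖ * ‖z‖) ≤
        |(inner ℝ (A i) w : ℝ) * inner ℝ (A i) z|).card : ℝ) := fun h0 => by
      rw [h0, Finset.filter_true_of_mem fun i _ => by rw [mul_zero]; exact abs_nonneg _, hG, mul_comm]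
      gcongr
    by_cases hw : w = 0
    · exact htriv (by simp [hw])
    by_cases hz : z = 0
    · exact htriv (by simp [hz])
    have hpos : 0 < ‖w‖ * ‖z‖ := mul_pos (norm_pos_iff.2 hw) (norm_pos_iff.2 hz)
    simp_rw [scale w z _ hw hz, mul_comm (κ ^ 2 / 4), mul_le_mul_iff_right₀ hpos]
    have hu := norm_smul_inv_norm (𝕜 := ℝ) hw
    have hv := norm_smul_inv_norm (𝕜 := ℝ) hz
    simp only [RCLike.ofReal_real_eq_id, id] at hu hv
    obtain ⟨u', hu's, huu'⟩ := hs _ hu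
    obtain ⟨v', hv's, hvv'⟩ := hs _ hv
    have h1 := card_filter_min_le hκ hA hmC G huu' hvv'
    have h2 := h.smallBall u' hu's v' hv's
    rw [hG] at h2
    have h3 := mul_lt_mul_of_pos_left hq hm'
    have e : 8 * (m * C) * ε ^ 2 / κ ^ 2 = m * (8 * C * ε ^ 2 / κ ^ 2) := by ring
    rw [e] at h1
    linarith

/-- Two-sided comparison of the quantile with the objective gap. -/
lemma UniformBounds.quantile_mem_Icc {G : Finset (Fin m)} {g C h pfail ptil : ℝ}
    {b : Fin m → ℝ} {xs : EuclideanSpace ℝ (Fin n)} (hm : 0 < m)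
    (hU : UniformBounds A G g C h (1 - ptil)) (hg : 0 < g) (hC : 0 < C) (hh : 0 < h)
    (hb : ∀ i ∈ G, b i = (inner ℝ (A i) xs : ℝ) ^ 2) (hG : (G.card : ℝ) = (1 - pfail) * m)
    (hp0 : 0 < ptil) (hp1 : ptil < 1 - pfail) (hp2 : ptil ≤ 1)
    (hk : ∃ k : ℕ, (m : ℝ) * ptil = k) (x : EuclideanSpace ℝ (Fin n)) :
    quantile (absResidual A b x) ptil ∈
      Set.Icc (h / C * (objective A b x - objective A b xs))
        (C / (1 - pfail - ptil) / g * (objective A b x - objective A b xs)) := by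
  obtain ⟨k, hk⟩ := hk
  have hm' : (0 : ℝ) < m := Nat.cast_pos.2 hm
  have hk1 : 1 ≤ k := by
    have : (0 : ℝ) < k := by rw [← hk]; positivity
    exact_mod_cast this
  have hkm : k ≤ m := by
    have : (k : ℝ) ≤ m := by rw [← hk]; exact mul_le_of_le_one_right hm'.le hp2
    exact_mod_cast this
  have hq : quantile (absResidual A b x) ptil = orderStat (absResidual A b x) k := by
    rw [quantile, hk, Nat.floor_natCast]
  set D : Fin m → ℝ := fun i => |(inner ℝ (A i) (x - xs) : ℝ) * inner ℝ (A i) (x + xs)| with hD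
  set d := ‖x - xs‖ * ‖x + xs‖ with hd
  have hd0 : 0 ≤ d := by positivity
  have hDeq : ∀ i, D i = |(inner ℝ (A i) x : ℝ) ^ 2 - (inner ℝ (A i) xs : ℝ) ^ 2| := fun i => by
    simp only [hD, inner_sub_right, inner_add_right]
    ring_nf
  have hrG : ∀ i ∈ G, absResidual A b x i = D i := fun i hi => by
    rw [absResidual, hb i hi, hDeq]
  have hrsG : ∀ i ∈ G, absResidual A b xs i = 0 := fun i hi => by
    rw [absResidual, hb i hi, sub_self, abs_zero]
  -- By the reverse triangle inequality `b i` cancels, so arbitrary corruptions are allowed.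
  have hr : ∀ i, |absResidual A b x i - absResidual A b xs i| ≤ D i := fun i => by
    rw [hDeq]
    refine (abs_abs_sub_abs_le _ _).trans (le_of_eq ?_)
    ring_nf
  have hobj : m * (objective A b x - objective A b xs) =
      ∑ i, (absResidual A b x i - absResidual A b xs i) := by
    rw [objective, objective, Finset.sum_sub_distrib]
    field_simp
  have hlow : g * d ≤ objective A b x - objective A b xs := by
    refine le_of_mul_le_mul_left ?_ hm'
    rw [hobj, ← Finset.sum_add_sum_compl G]
    have h1 : ∑ i ∈ G, (absResidual A b x i - absResidual A b xs i) = ∑ i ∈ G, D i :=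
      Finset.sum_congr rfl fun i hi => by rw [hrG i hi, hrsG i hi, sub_zero]
    have h2 : -∑ i ∈ Gᶜ, D i ≤ ∑ i ∈ Gᶜ, (absResidual A b x i - absResidual A b xs i) := by
      rw [← Finset.sum_neg_distrib]
      exact Finset.sum_le_sum fun i _ => (abs_le.1 (hr i)).1
    have h3 := hU.sharp (x - xs) (x + xs)
    linarith
  have hupp : objective A b x - objective A b xs ≤ C * d := by
    refine le_of_mul_le_mul_left ?_ hm'
    rw [hobj, ← mul_assoc]
    exact (Finset.sum_le_sum fun i _ => (abs_le.1 (hr i)).2).trans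
      (hU.upper (x - xs) (x + xs) Finset.univ)
  rw [hq]
  have hgap : 0 < 1 - pfail - ptil := by linarith
  constructor
  · calc h / C * (objective A b x - objective A b xs) ≤ h / C * (C * d) := by gcongr
      _ = h * d := by field_simp
      _ ≤ _ := by
        refine le_orderStat _ hk1 hkm ?_
        -- More than `(1 - ptil) m` clean residuals are at least `h d`; this leaves fewer than `ptil
        -- m = k` indices below `h d`.
        have h1 : (G.filter fun i => h * d ≤ D i).card +
            (Finset.univ.filter fun i => absResidual A b x i < h * d).card ≤ m := by
          rw [← Finset.card_union_of_disjoint]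
          · exact (Finset.card_le_univ _).trans_eq (Fintype.card_fin m)
          · rw [Finset.disjoint_left]
            intro i hi hi'
            simp only [Finset.mem_filter, Finset.mem_univ, true_and] at hi hi'
            rw [hrG i hi.1] at hi'
            linarith [hi.2]
        have h2 := hU.count (x - xs) (x + xs)
        have h3 : ((G.filter fun i => h * d ≤ D i).card : ℝ) +
            (Finset.univ.filter fun i => absResidual A b x i < h * d).card ≤ m := by
          exact_mod_cast h1
        have h4 : ((Finset.univ.filter fun i => absResidual A b x i < h * d).card : ℝ) < k := by
          rw [← hk]
          linarith
        exact_mod_cast h4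
  · calc orderStat (absResidual A b x) k ≤ C / (1 - pfail - ptil) * d := by
          refine orderStat_le _ hk1 ?_
          -- The level is chosen so that Markov's inequality leaves at least `(1 - pfail) m - (1 -
          -- pfail - ptil) m = k` clean indices below it. The case `d = 0` is separate, since the
          -- inequality then divides by zero.
          have hbadcount : ((G.filter fun i => ¬ D i ≤ C / (1 - pfail - ptil) * d).card : ℝ) ≤
              m * (1 - pfail - ptil) := by
            have hup := hU.upper (x - xs) (x + xs) G
            rcases hd0.eq_or_lt with h0 | hdpos
            · have hz : ∀ i ∈ G, D i = 0 := by
                rw [← hd, ← h0, mul_zero] at hup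
                exact (Finset.sum_eq_zero_iff_of_nonneg fun i _ => abs_nonneg _).1
                  (le_antisymm hup (Finset.sum_nonneg fun i _ => abs_nonneg _))
              rw [Finset.filter_false_of_mem fun i hi => by rw [hz i hi, ← h0]; simp]
              simp only [Finset.card_empty, Nat.cast_zero]
              positivity
            · have h1 := card_filter_mul_le_sum G (f := D) (fun i => abs_nonneg _)
                (C / (1 - pfail - ptil) * d)
              have h2 : ((G.filter fun i => ¬ D i ≤ C / (1 - pfail - ptil) * d).card : ℝ) ≤
                  (G.filter fun i => C / (1 - pfail - ptil) * d ≤ D i).card := by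
                exact_mod_cast Finset.card_le_card
                  (Finset.monotone_filter_right G fun i _ hi => (not_le.1 hi).le)
              have hpos : 0 < C / (1 - pfail - ptil) * d := by positivity
              refine h2.trans (le_of_mul_le_mul_right (h1.trans (hup.trans_eq ?_)) hpos)
              rw [← hd]
              field_simp
          have hsplit := Finset.card_filter_add_card_filter_not (s := G)
            (fun i => D i ≤ C / (1 - pfail - ptil) * d)
          have hsplit' : ((G.filter fun i => D i ≤ C / (1 - pfail - ptil) * d).card : ℝ) +
              (G.filter fun i => ¬ D i ≤ C / (1 - pfail - ptil) * d).card = G.card := by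
            exact_mod_cast hsplit
          have hsub : (G.filter fun i => D i ≤ C / (1 - pfail - ptil) * d) ⊆
              Finset.univ.filter fun i => absResidual A b x i ≤ C / (1 - pfail - ptil) * d := by
            intro i hi
            simp only [Finset.mem_filter, Finset.mem_univ, true_and] at hi ⊢
            rw [hrG i hi.1]
            exact hi.2
          refine le_trans ?_ (Finset.card_le_card hsub)
          have : (k : ℝ) ≤ (G.filter fun i => D i ≤ C / (1 - pfail - ptil) * d).card := by
            rw [← hk]
            linarith
          exact_mod_cast this
      _ = C / (1 - pfail - ptil) / g * (g * d) := by field_simp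
      _ ≤ _ := by gcongr

end Deterministic

/-! ### Union bound over the net. -/

section Probability

/-- The four deviation estimates hold on a finite set of directions up to exponentially small
probability, with a rate depending only on the sub-Gaussian constant and the deviation. -/
lemma exists_measure_not_goodSample_le (σ : ℝ≥0) {t : ℝ} (ht : 0 < t) :
    ∃ c : ℝ, 0 < c ∧ ∀ {n m : ℕ} {Ω : Type*} [MeasurableSpace Ω] (μ : Measure Ω)
      [IsProbabilityMeasure μ] (ν : Measure (EuclideanSpace ℝ (Fin n))) [IsProbabilityMeasure ν]
      (a : Fin m → Ω → EuclideanSpace ℝ (Fin n)) (G : Finset (Fin m)) (κ : ℝ)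
      (s : Finset (EuclideanSpace ℝ (Fin n))),
      (∀ i, Measurable (a i)) → (∀ i, μ.map (a i) = ν) → iIndepFun a μ →
      ∫ y, y ∂ν = 0 → IsSubGaussian ν σ → (∀ u ∈ s, ‖u‖ = 1) →
      μ.real {ω | ¬ GoodSample (fun i => a i ω) G (specNorm (covarianceMatrix ν)) (kappaSt ν) κ
        (smallBallProb ν κ) t s} ≤ (s.card : ℝ) ^ 2 * (4 * Real.exp (-(m * c))) := by
  obtain ⟨l₀, K, hl₀, hK, hmom⟩ := exists_exp_moment_inner_mul_inner σ
  -- The second entry bounds the exponential moment of the small-ball indicator, so products and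
  -- indicators share one rate.
  set K' := max K (Real.exp l₀) with hK'
  have hK'0 : 0 < K' := hK.trans_le (le_max_left _ _)
  obtain ⟨l, c, hl, hl2, hc, hcl⟩ := exists_chernoff_parameter hl₀ hK'0 ht
  refine ⟨c, hc, ?_⟩
  intro n m Ω _ μ _ ν _ a G κ s ha hlaw hind hmean hν hs
  have hcard : ∀ I : Finset (Fin m), (I.card : ℝ) ≤ m := fun I => by
    exact_mod_cast (Finset.card_le_univ I).trans_eq (Fintype.card_fin m)
  have chern : ∀ (f : EuclideanSpace ℝ (Fin n) → ℝ) (I : Finset (Fin m)), Measurable f →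
      Integrable (fun y => Real.exp (l₀ * |f y|)) ν → ∫ y, Real.exp (l₀ * |f y|) ∂ν ≤ K' →
      μ.real {ω | (I.card : ℝ) * ∫ y, f y ∂ν + m * t ≤ ∑ i ∈ I, f (a i ω)} ≤
        Real.exp (-(m * c)) := fun f I hf hint hle =>
    measure_sum_ge_le_exp ha hlaw hind hf hl₀ hl hl2 hint hle hcl I (hcard I)
  let P : EuclideanSpace ℝ (Fin n) → EuclideanSpace ℝ (Fin n) → EuclideanSpace ℝ (Fin n) → ℝ :=
    fun u v y => |(inner ℝ y u : ℝ) * inner ℝ y v|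
  let T : EuclideanSpace ℝ (Fin n) → EuclideanSpace ℝ (Fin n) → Set (EuclideanSpace ℝ (Fin n)) :=
    fun u v => {y | κ ≤ min |(inner ℝ y u : ℝ)| |(inner ℝ y v : ℝ)|}
  have hT : ∀ u v, MeasurableSet (T u v) := fun u v =>
    measurableSet_le measurable_const (by fun_prop)
  have hPm : ∀ u v, Measurable (P u v) := fun u v => by fun_prop
  let Q : EuclideanSpace ℝ (Fin n) → EuclideanSpace ℝ (Fin n) → EuclideanSpace ℝ (Fin n) → ℝ :=
    fun u v => (T u v).indicator fun _ => 1
  have hQm : ∀ u v, Measurable (Q u v) := fun u v => measurable_const.indicator (hT u v)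
  -- One event for each field of `GoodSample`; lower tails are written as upper tails of `-P` and
  -- `-Q`.
  let bad : EuclideanSpace ℝ (Fin n) → EuclideanSpace ℝ (Fin n) → Set Ω := fun u v =>
    (({ω | (G.card : ℝ) * ∫ y, -P u v y ∂ν + m * t ≤ ∑ i ∈ G, -P u v (a i ω)} ∪
      {ω | (Gᶜ.card : ℝ) * ∫ y, P u v y ∂ν + m * t ≤ ∑ i ∈ Gᶜ, P u v (a i ω)}) ∪
      {ω | ((Finset.univ : Finset (Fin m)).card : ℝ) * ∫ y, P u u y ∂ν + m * t ≤ ∑ i, P u u (a i ω)}) ∪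
      {ω | (G.card : ℝ) * ∫ y, -Q u v y ∂ν + m * t ≤ ∑ i ∈ G, -Q u v (a i ω)}
  have hbad : ∀ u ∈ s, ∀ v ∈ s, μ.real (bad u v) ≤ 4 * Real.exp (-(m * c)) := by
    intro u hu v hv
    obtain ⟨i1, i2⟩ := hmom n ν hν u v (hs u hu) (hs v hv)
    obtain ⟨j1, j2⟩ := hmom n ν hν u u (hs u hu) (hs u hu)
    have hP' := i2.trans (le_max_left K (Real.exp l₀))
    have hPu' := j2.trans (le_max_left K (Real.exp l₀))
    have hQle : ∀ y, Real.exp (l₀ * |-Q u v y|) ≤ Real.exp l₀ := fun y => by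
      refine Real.exp_le_exp.2 (mul_le_of_le_one_right hl₀.le ?_)
      rw [abs_neg]
      by_cases hy : y ∈ T u v <;> simp [Q, hy]
    have hQi : Integrable (fun y => Real.exp (l₀ * |-Q u v y|)) ν := by
      refine (integrable_const (Real.exp l₀)).mono' ?_ (ae_of_all _ fun y => ?_)
      · have := hQm u v
        fun_prop
      · rw [Real.norm_eq_abs, Real.abs_exp]
        exact hQle y
    have hQ' : ∫ y, Real.exp (l₀ * |-Q u v y|) ∂ν ≤ K' := by
      refine le_trans ?_ (le_max_right K (Real.exp l₀))
      refine (integral_mono hQi (integrable_const _) hQle).trans_eq ?_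
      simp
    have e1 := chern (fun y => -P u v y) G (hPm u v).neg
      (by simpa only [P, abs_neg, abs_abs] using i1)
      (by simpa only [P, abs_neg, abs_abs] using hP')
    have e2 := chern (P u v) Gᶜ (hPm u v) (by simpa only [P, abs_abs] using i1)
      (by simpa only [P, abs_neg, abs_abs] using hP')
    have e3 := chern (P u u) Finset.univ (hPm u u) (by simpa only [P, abs_neg, abs_abs] using j1)
      (by simpa only [P, abs_neg, abs_abs] using hPu')
    have e4 := chern (fun y => -Q u v y) G (hQm u v).neg hQi hQ'
    refine (measureReal_union_le _ _).trans ?_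
    have f1 := measureReal_union_le (μ := μ)
      ({ω | (G.card : ℝ) * ∫ y, -P u v y ∂ν + m * t ≤ ∑ i ∈ G, -P u v (a i ω)} ∪
      {ω | (Gᶜ.card : ℝ) * ∫ y, P u v y ∂ν + m * t ≤ ∑ i ∈ Gᶜ, P u v (a i ω)})
      {ω | ((Finset.univ : Finset (Fin m)).card : ℝ) * ∫ y, P u u y ∂ν + m * t ≤ ∑ i, P u u (a i ω)}
    have f2 := measureReal_union_le (μ := μ)
      {ω | (G.card : ℝ) * ∫ y, -P u v y ∂ν + m * t ≤ ∑ i ∈ G, -P u v (a i ω)}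
      {ω | (Gᶜ.card : ℝ) * ∫ y, P u v y ∂ν + m * t ≤ ∑ i ∈ Gᶜ, P u v (a i ω)}
    linarith
  have hsub : {ω | ¬ GoodSample (fun i => a i ω) G (specNorm (covarianceMatrix ν)) (kappaSt ν) κ
        (smallBallProb ν κ) t s} ⊆ ⋃ p ∈ s ×ˢ s, bad p.1 p.2 := by
    intro ω hω
    by_contra hcon
    refine hω ?_
    simp only [Set.mem_iUnion, not_exists, Finset.mem_product, Prod.forall] at hcon
    have hno : ∀ u ∈ s, ∀ v ∈ s,
        (∑ i ∈ G, -P u v (a i ω) < (G.card : ℝ) * ∫ y, -P u v y ∂ν + m * t) ∧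
        (∑ i ∈ Gᶜ, P u v (a i ω) < (Gᶜ.card : ℝ) * ∫ y, P u v y ∂ν + m * t) ∧
        (∑ i, P u u (a i ω) < (m : ℝ) * ∫ y, P u u y ∂ν + m * t) ∧
        (∑ i ∈ G, -Q u v (a i ω) < (G.card : ℝ) * ∫ y, -Q u v y ∂ν + m * t) := by
      intro u hu v hv
      have := hcon u v ⟨hu, hv⟩
      simpa [bad, and_assoc] using this
    refine ⟨fun u hu v hv => ?_, fun u hu v hv => ?_, fun u hu => ?_, fun u hu v hv => ?_⟩
    · have h1 := (hno u hu v hv).1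
      rw [Finset.sum_neg_distrib, integral_neg] at h1
      have h2 := mul_le_mul_of_nonneg_left (kappaSt_le (ν := ν) (hs u hu) (hs v hv))
        (Nat.cast_nonneg (α := ℝ) G.card)
      simp only [P] at h1
      linarith
    · have h1 := (hno u hu v hv).2.1
      have h2 := mul_le_mul_of_nonneg_left
        (integral_abs_inner_mul_inner_le hν hmean (hs u hu) (hs v hv))
        (Nat.cast_nonneg (α := ℝ) Gᶜ.card)
      simp only [P] at h1
      linarith
    · have h1 := (hno u hu u hu).2.2.1
      have h2 := mul_le_mul_of_nonneg_left
        (integral_abs_inner_mul_inner_le hν hmean (hs u hu) (hs u hu))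
        (Nat.cast_nonneg (α := ℝ) m)
      simp only [P] at h1
      have h3 : ∀ i, (inner ℝ (a i ω) u : ℝ) ^ 2 =
          |(inner ℝ (a i ω) u : ℝ) * inner ℝ (a i ω) u| := fun i => by
        rw [abs_mul_self, sq]
      simp_rw [h3]
      linarith
    · have h1 := (hno u hu v hv).2.2.2
      rw [Finset.sum_neg_distrib, integral_neg] at h1
      have h2 := mul_le_mul_of_nonneg_left (smallBallProb_le (ν := ν) (κ := κ) (hs u hu) (hs v hv))
        (Nat.cast_nonneg (α := ℝ) G.card)
      have h3 : ∫ y, Q u v y ∂ν = ν.real (T u v) := integral_indicator_one (hT u v)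
      have h4 : ∑ i ∈ G, Q u v (a i ω) = ((G.filter fun i => κ ≤
          min |(inner ℝ (a i ω) u : ℝ)| |(inner ℝ (a i ω) v : ℝ)|).card : ℝ) := by
        rw [Finset.card_filter]
        push_cast
        refine Finset.sum_congr rfl fun i _ => ?_
        simp only [Q, T, Set.indicator_apply, Set.mem_ofPred_eq]
      rw [h3, h4] at h1
      simp only [T] at h1
      linarith
  calc _ ≤ μ.real (⋃ p ∈ s ×ˢ s, bad p.1 p.2) := measureReal_mono hsub (measure_ne_top _ _)
    _ ≤ ∑ p ∈ s ×ˢ s, μ.real (bad p.1 p.2) := measureReal_biUnion_finset_le _ _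
    _ ≤ ∑ p ∈ s ×ˢ s, 4 * Real.exp (-(m * c)) := Finset.sum_le_sum fun p hp => by
        rw [Finset.mem_product] at hp
        exact hbad _ hp.1 _ hp.2
    _ = _ := by
        rw [Finset.sum_const, Finset.card_product, nsmul_eq_mul]
        push_cast
        ring

/-- Subadditivity needs no measurability, which matters because the final event is an uncountable
intersection over `x`. -/
lemma one_sub_le_measureReal_of_compl_le {Ω : Type*} [MeasurableSpace Ω] {μ : Measure Ω}
    [IsProbabilityMeasure μ] {s t : Set Ω} {r : ℝ} (hst : sᶜ ⊆ t) (h : μ.real t ≤ r) :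
    1 - r ≤ μ.real s := by
  have h1 : (1 : ℝ) ≤ μ.real s + μ.real t := by
    have : s ∪ t = Set.univ := by
      rw [Set.eq_univ_iff_forall]
      intro x
      by_cases hx : x ∈ s
      · exact Or.inl hx
      · exact Or.inr (hst hx)
    rw [← probReal_univ (μ := μ), ← this]
    exact measureReal_union_le _ _
  linarith

end Probability

end RobustPhaseRetrieval

/-! ### Choice of the constants and conclusion. -/

/-- The parameters enter as real numbers and are tied to the law only after the constants are
chosen; this expresses that the constants depend on nothing else. -/
theorem mainTheorem1
    (σ : ℝ≥0) (S κst κ p₀ pfail ptil : ℝ)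
    (hpfail : pfail < 1 / 2)
    (hgap : 0 < κst - 2 * pfail * S)
    (hptil : ptil ∈ Set.Ioo pfail (1 - pfail))
    (hκ : 0 < κ)
    (hp₀ : (1 - ptil) / (1 - pfail) < p₀) :
    ∃ uL uH ρ₁ ρ₂ ρ₃ : ℝ, 0 < uL ∧ 0 < uH ∧ 0 < ρ₁ ∧ 0 < ρ₂ ∧ 0 < ρ₃ ∧
      ∀ (n m₁ m₂ : ℕ) (Ω : Type*) [MeasurableSpace Ω] (μ : Measure Ω) [IsProbabilityMeasure μ]
        (ν : Measure (EuclideanSpace ℝ (Fin n)))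
        (a : Fin (m₁ + m₂) → Ω → EuclideanSpace ℝ (Fin n)) (ξ : Fin m₂ → Ω → ℝ)
        (xs : EuclideanSpace ℝ (Fin n)),
        DataModel μ ν σ a ξ xs →
        pfail = (m₂ : ℝ) / ((m₁ + m₂ : ℕ) : ℝ) →
        S = specNorm (covarianceMatrix ν) →
        κst = kappaSt ν →
        p₀ = smallBallProb ν κ →
        (∃ k : ℕ, ((m₁ + m₂ : ℕ) : ℝ) * ptil = k) →
        ρ₁ * (n : ℝ) ≤ ((m₁ + m₂ : ℕ) : ℝ) →
        1 - ρ₂ * Real.exp (-(((m₁ + m₂ : ℕ) : ℝ) * ρ₃)) ≤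
          μ.real {ω | ∀ x : EuclideanSpace ℝ (Fin n),
            let A : Fin (m₁ + m₂) → EuclideanSpace ℝ (Fin n) := fun i => a i ω
            let b : Fin (m₁ + m₂) → ℝ := measurements A xs (fun j => ξ j ω)
            quantile (absResidual A b x) ptil ∈
              Set.Icc (uL * (objective A b x - objective A b xs))
                (uH * (objective A b x - objective A b xs))} := by
  obtain ⟨hpt1, hpt2⟩ := hptil
  set g := κst - 2 * pfail * S with hg
  set δ := (1 - pfail) * p₀ - (1 - ptil) with hδ
  have hδ0 : 0 < δ := by
    rw [div_lt_iff₀ (by linarith)] at hp₀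
    rw [hδ]
    linarith
  -- Error budget: `2 t` and `4 C ε` each use at most `g / 4`, leaving sharpness `g / 2`; in the
  -- count, deviation and net error each use at most `δ / 4`, so the inequality stays strict.
  set t := min 1 (min (g / 8) (δ / 4)) with ht
  have ht0 : 0 < t := lt_min one_pos (lt_min (by positivity) (by positivity))
  have ht1 : t ≤ g / 8 := (min_le_right _ _).trans (min_le_left _ _)
  have ht2 : t ≤ δ / 4 := (min_le_right _ _).trans (min_le_right _ _)
  -- The absolute value is needed because `S` is not yet known to be a norm.
  set C := 4 * (|S| + t) with hC
  have hC0 : 0 < C := by positivity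
  set ε := min (1 / 2) (min (g / (16 * C)) (δ * κ ^ 2 / (32 * C))) with hε
  have hε0 : 0 < ε := lt_min (by norm_num) (lt_min (by positivity) (by positivity))
  have hε1 : ε ≤ 1 / 2 := min_le_left _ _
  have hε2 : 4 * C * ε ≤ g / 4 := by
    have : ε ≤ g / (16 * C) := (min_le_right _ _).trans (min_le_left _ _)
    rw [le_div_iff₀ (by positivity)] at this
    linarith
  have hε3 : 8 * C * ε ^ 2 / κ ^ 2 ≤ δ / 4 := by
    have : ε ≤ δ * κ ^ 2 / (32 * C) := (min_le_right _ _).trans (min_le_right _ _)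
    rw [le_div_iff₀ (by positivity)] at this
    rw [div_le_iff₀ (by positivity)]
    have hsq : ε ^ 2 ≤ ε := by rw [sq]; exact mul_le_of_le_one_left hε0.le (by linarith)
    have := mul_le_mul_of_nonneg_left hsq hC0.le
    linarith
  obtain ⟨c, hc0, hprob⟩ := exists_measure_not_goodSample_le σ ht0
  have hlog : 0 < Real.log (1 + 2 / ε) := Real.log_pos (by
    have : 0 < 2 / ε := by positivity
    linarith)
  -- With this `ρ₁` the squared net size is at most `exp (m c / 2)`, half of the Chernoff exponent;
  -- the factor `4` counts the bad events of a pair.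
  refine ⟨κ ^ 2 / 4 / C, C / (1 - pfail - ptil) / (g / 2), 4 * Real.log (1 + 2 / ε) / c, 4, c / 2,
    by positivity, ?_, by positivity, by norm_num, by positivity, ?_⟩
  · have : 0 < 1 - pfail - ptil := by linarith
    positivity
  intro n m₁ m₂ Ω _ μ _ ν a ξ xs hdata hpf hS hκst hp₀' hk hmn
  -- A nonzero signal excludes `n = 0`; this yields `m > 0` and the unit vector used for `κst ≤ S`.
  have hn : 0 < n := by
    rcases Nat.eq_zero_or_pos n with rfl | h
    · exact absurd (Subsingleton.elim xs 0) hdata.signal_ne_zero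
    · exact h
  have hm' : (0 : ℝ) < ((m₁ + m₂ : ℕ) : ℝ) := lt_of_lt_of_le (by positivity) hmn
  have hm : 0 < m₁ + m₂ := by exact_mod_cast hm'
  have hν : IsProbabilityMeasure ν := by
    rw [← hdata.law_a ⟨0, hm⟩]
    exact Measure.isProbabilityMeasure_map (hdata.measurable_a _).aemeasurable
  have hpf0 : 0 ≤ pfail := by rw [hpf]; positivity
  have hS0 : 0 ≤ S := by rw [hS]; exact norm_nonneg _
  have hκS : κst ≤ S := by
    have hu : ‖EuclideanSpace.single (⟨0, hn⟩ : Fin n) (1 : ℝ)‖ = 1 := by simp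
    rw [hκst, hS]
    exact (kappaSt_le hu hu).trans
      (integral_abs_inner_mul_inner_le hdata.subGaussian hdata.mean_zero hu hu)
  obtain ⟨s, hs1, hs, hscard⟩ := exists_net_sphere (E := EuclideanSpace ℝ (Fin n)) hε0
  rw [finrank_euclideanSpace_fin] at hscard
  set G : Finset (Fin (m₁ + m₂)) := Finset.univ.filter fun i => (i : ℕ) < m₁ with hGdef
  have hGcard : G.card = m₁ := by
    rw [hGdef, Fin.card_filter_val_lt]
    exact min_eq_right (Nat.le_add_right _ _)
  have hGccard : Gᶜ.card = m₂ := by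
    rw [Finset.card_compl, hGcard, Fintype.card_fin, Nat.add_sub_cancel_left]
  have hm₂ : (m₂ : ℝ) = pfail * ((m₁ + m₂ : ℕ) : ℝ) := by
    rw [hpf, div_mul_cancel₀ _ hm'.ne']
  have hm₁ : (m₁ : ℝ) = (1 - pfail) * ((m₁ + m₂ : ℕ) : ℝ) := by
    rw [sub_mul, ← hm₂]
    push_cast
    ring
  have key := hprob μ ν a G κ s hdata.measurable_a hdata.law_a hdata.indep_a hdata.mean_zero
    hdata.subGaussian hs1
  rw [← hS, ← hκst, ← hp₀'] at key
  refine one_sub_le_measureReal_of_compl_le (t := {ω | ¬ GoodSample (fun i => a i ω) G S κst κ p₀ t s})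
    (fun ω hω hgood => hω ?_) (key.trans ?_)
  · have hU : UniformBounds (fun i => a i ω) G (g / 2) C (κ ^ 2 / 4) (1 - ptil) := by
      refine hgood.uniformBounds (pfail := pfail) (ε := ε) hm hs1 hs hε1 hκ (by positivity)
        (by rw [hC, abs_of_nonneg hS0]) (by rw [hGcard, hm₁]) (by rw [hGccard, hm₂]) ?_ ?_
        (by linarith)
      -- Here `(1 - pfail) κst - pfail S = g + pfail (S - κst) ≥ g`.
      · have := mul_le_mul_of_nonneg_left hκS hpf0
        linarith
      · linarith
    intro x
    refine hU.quantile_mem_Icc hm (by positivity) hC0 (by positivity) ?_ (by rw [hGcard, hm₁])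
      (by linarith) hpt2 (by linarith) hk x
    intro i hi
    rw [hGdef, Finset.mem_filter] at hi
    have hi' : i = Fin.castAdd m₂ ⟨i, hi.2⟩ := Fin.ext rfl
    rw [hi', measurements, Fin.append_left]
  · have h1 : (s.card : ℝ) ^ 2 ≤ Real.exp (((m₁ + m₂ : ℕ) : ℝ) * c / 2) := by
      calc (s.card : ℝ) ^ 2 ≤ ((1 + 2 / ε) ^ n) ^ 2 :=
          pow_le_pow_left₀ (Nat.cast_nonneg _) hscard 2
        _ = Real.exp (2 * n * Real.log (1 + 2 / ε)) := by
          rw [← pow_mul, mul_comm (2 * (n : ℝ)), ← Real.rpow_def_of_pos (by positivity),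
            ← Real.rpow_natCast]
          push_cast
          rw [mul_comm]
        _ ≤ _ := by
          rw [Real.exp_le_exp]
          rw [div_mul_eq_mul_div, div_le_iff₀ hc0] at hmn
          linarith
    calc (s.card : ℝ) ^ 2 * (4 * Real.exp (-(((m₁ + m₂ : ℕ) : ℝ) * c)))
        ≤ Real.exp (((m₁ + m₂ : ℕ) : ℝ) * c / 2) *
          (4 * Real.exp (-(((m₁ + m₂ : ℕ) : ℝ) * c))) := by gcongr
      _ = 4 * (Real.exp (((m₁ + m₂ : ℕ) : ℝ) * c / 2) *
          Real.exp (-(((m₁ + m₂ : ℕ) : ℝ) * c))) := by ring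
      _ = _ := by
        rw [← Real.exp_add]
        congr 2
        ring
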